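/- Let $X$ be a dendrite, that is, a compact, connected, locally connected (nonempty) metric space which contains no subspace homeomorphic to the unit circle, and let $f\colon X\to X$ be a continuous map. Write $f^n$ for the $n$-th iterate of $f$ and $\mathrm{Fix}(f^n)=\{x\in X : f^n(x)=x\}$. An arc in $X$ is a subspace homeomorphic to $[0,1]$; for distinct $x,y\in X$ there is exactly one arc in $X$ with endpoints $x$ and $y$, and it is denoted by $xy$. An arc $A\subseteq X$ is called $f$-expanding if $A\subsetneq f^n[A]$ for some integer $n\ge 1$. Then the following are equivalent: 1. $X$ contains an $f$-expanding arc; 2. for some integer $n\ge 1$, the set $\mathrm{Fix}(f^n)$ is disconnected, i.e. it is the union of two disjoint nonempty relatively open subsets; 3. there exist points $x,y\in X$ and an integer $n\ge 1$ such that $f^n(x)=x$, $f^n(y)\ne y$, and $x\neq f^n(y)$ with $y$ lying on the arc $xf^n(y)$. -/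

import Mathlib

/-- `A` is an arc: a subspace homeomorphic to the unit interval `[0,1]`. -/
def IsArc {X : Type*} [TopologicalSpace X] (A : Set X) : Prop :=
  Nonempty (unitInterval ≃ₜ A)

/-- `A` is an arc joining `x` to `y`, that is, an arc whose two endpoints are `x` and `y`.
(This forces `x ≠ y`.) -/
def IsArcBetween {X : Type*} [TopologicalSpace X] (A : Set X) (x y : X) : Prop :=
  ∃ h : unitInterval ≃ₜ A, (h 0 : X) = x ∧ (h 1 : X) = y

/-- `S` is a simple closed curve: a subspace homeomorphic to the unit circle. -/
def IsSimpleClosedCurve {X : Type*} [TopologicalSpace X] (S : Set X) : Prop :=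
  Nonempty (Circle ≃ₜ S)

/-- A dendrite: a locally connected continuum (compact connected metric space, in particular
nonempty) that contains no simple closed curve. -/
structure IsDendrite (X : Type*) [MetricSpace X] : Prop where
  compact : CompactSpace X
  connected : ConnectedSpace X
  locallyConnected : LocallyConnectedSpace X
  no_simpleClosedCurve : ∀ S : Set X, ¬ IsSimpleClosedCurve S

/-- `A` is an `f`-expanding arc: an arc with `A ⊊ f^n[A]` for some positive integer `n`. -/
def IsExpandingArc {X : Type*} [TopologicalSpace X] (f : X → X) (A : Set X) : Prop :=
  IsArc A ∧ ∃ n : ℕ, 0 < n ∧ A ⊂ f^[n] '' A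

/-!
Two points of a connected, locally connected compact metric space are joined by an arc: such a
space is locally path-connected (`LocallyPathConnectedSpace.of_complete_locallyConnected`), and
every path contains an arc with the same ends (`JoinedIn.exists_injOn`). If there are no simple
closed curves, the arc from `x` to `z` lies in every connected set containing its ends
(`between_of_injOn`), so it is the set of points `y` with `Between x y z`. For fixed `x`, the
relation `Between x y z` is a closed partial order on `y` and `z`, with root `x`, and most of the
argument takes place in this order.

The main tool is `exists_fixedPoint_beyond`: if `y` is between `x` and `g y`, then `g` has a fixed
point `w` with `y` between `x` and `w`.

* An expanding arc forces disconnected fixed points. Let `A`, with ends `a` and `b`, be expanded by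
  an iterate `g`, and let `p, q ∈ A` be mapped to `a`, `b`. If `p` precedes `q`, then `g` moves `p`
  away from `b` and `q` away from `a`, so there are fixed points beyond `p` and beyond `q`. Were the
  set of fixed points connected, it would contain `p` and `q`, so `p = a` and `q = b`, hence all of
  `A`, and `A` would not be expanded. If `q` precedes `p`, the same applies to `g ∘ g`.
* If the fixed points of `g` are disconnected, some point `z` that is not fixed lies between two
  fixed points, and `g z` is separated by `z` from one of them.
* If `x` is fixed by `g` and `y` is between `x` and `g y ≠ y`, then the image of the arc from `x`
  to `y` is connected and contains `x` and `g y`, so it contains the arc, and the point `g y`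
  outside it.
-/

open Set Filter Topology Metric

/-! ### Complete locally connected metric spaces are locally path-connected -/

/-- `a` and `b` lie in a common preconnected set of diameter at most `ε`. -/
def SmallLinked {X : Type*} [MetricSpace X] (ε : ℝ) (a b : X) : Prop :=
  ∃ S : Set X, IsPreconnected S ∧ a ∈ S ∧ b ∈ S ∧ ∀ u ∈ S, ∀ v ∈ S, dist u v ≤ ε

theorem SmallLinked.dist_le {X : Type*} [MetricSpace X] {ε : ℝ} {a b : X}
    (h : SmallLinked ε a b) : dist a b ≤ ε := by
  obtain ⟨S, -, ha, hb, hS⟩ := h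
  exact hS a ha b hb

theorem SmallLinked.refl {X : Type*} [MetricSpace X] {ε : ℝ} (hε : 0 ≤ ε) (a : X) :
    SmallLinked ε a a :=
  ⟨{a}, isPreconnected_singleton, rfl, rfl, by rintro u rfl v rfl; simpa using hε⟩

theorem SmallLinked.symm {X : Type*} [MetricSpace X] {ε : ℝ} {a b : X}
    (h : SmallLinked ε a b) : SmallLinked ε b a := by
  obtain ⟨S, h, ha, hb, hS⟩ := h
  exact ⟨S, h, hb, ha, hS⟩

theorem eventually_smallLinked {X : Type*} [MetricSpace X] [LocallyConnectedSpace X]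
    {ε : ℝ} (hε : 0 < ε) (x : X) : ∀ᶠ y in 𝓝 x, SmallLinked ε x y := by
  obtain ⟨V, hV, hVc, hVs⟩ := locallyConnectedSpace_iff_connected_subsets.1 ‹_› x
    (ball x (ε / 2)) (ball_mem_nhds x (half_pos hε))
  filter_upwards [hV] with y hy
  refine ⟨V, hVc, mem_of_mem_nhds hV, hy, fun u hu v hv => ?_⟩
  have h1 := mem_ball.1 (hVs hu)
  have h2 := mem_ball.1 (hVs hv)
  linarith [dist_triangle_right u v x]

/-- Points linked at scale `ε` are joined by a finite chain linked at an arbitrarily small scale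
`δ`, which stays `ε`-close to its origin. The chain is indexed by `ℕ` and eventually constant. -/
theorem SmallLinked.exists_chain {X : Type*} [MetricSpace X] [LocallyConnectedSpace X]
    {ε δ : ℝ} (hδ : 0 < δ) {a b : X} (h : SmallLinked ε a b) :
    ∃ (n : ℕ) (c : ℕ → X), c 0 = a ∧ (∀ j, n ≤ j → c j = b) ∧ (∀ j, dist a (c j) ≤ ε) ∧
      ∀ j, SmallLinked δ (c j) (c (j + 1)) := by
  obtain ⟨S, hS, ha, hb, hd⟩ := h
  let P : X → X → Prop := fun x y => ∃ (n : ℕ) (c : ℕ → X), c 0 = x ∧ (∀ j, n ≤ j → c j = y) ∧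
    (∀ j, c j ∈ S) ∧ ∀ j, SmallLinked δ (c j) (c (j + 1))
  have key : ∀ x ∈ S, ∀ y ∈ S, SmallLinked δ x y → P x y := by
    intro x hx y hy hxy
    refine ⟨1, fun j => if j = 0 then x else y, by simp, fun j hj => by
      simp [show j ≠ 0 by omega], fun j => by dsimp only; split_ifs <;> assumption, fun j => ?_⟩
    by_cases hj : j = 0
    · simpa [hj] using hxy
    · simpa [hj] using SmallLinked.refl hδ.le y
  have hP : P a b := by
    refine hS.induction₂' P (fun x hx => ?_) (fun x y z _ _ _ hxy hyz => ?_) ha hb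
    · filter_upwards [nhdsWithin_le_nhds (eventually_smallLinked hδ x), self_mem_nhdsWithin]
        with y hy hyS
      exact ⟨key x hx y hyS hy, key y hyS x hx hy.symm⟩
    · obtain ⟨n, c, c0, cn, cS, cl⟩ := hxy
      obtain ⟨m, d, d0, dm, dS, dl⟩ := hyz
      refine ⟨n + m, fun j => if j < n then c j else d (j - n), ?_, fun j hj => ?_, fun j => ?_,
        fun j => ?_⟩
      · by_cases hn : 0 < n
        · simp [hn, c0]
        · have h0 : n = 0 := by omega
          simp only [h0, lt_irrefl, if_false, d0, Nat.sub_zero]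
          rw [← c0, cn 0 (by omega)]
      · simp only [show ¬ j < n by omega, if_false]
        exact dm _ (by omega)
      · dsimp only
        split_ifs
        exacts [cS j, dS _]
      · dsimp only
        by_cases h1 : j + 1 < n
        · simpa only [h1, show j < n by omega, if_true] using cl j
        · by_cases h2 : j < n
          · simp only [h1, h2, if_true, if_false, show j + 1 - n = 0 by omega, d0]
            rw [← cn (j + 1) (by omega)]
            exact cl j
          · simp only [h1, h2, if_false, show j + 1 - n = (j - n) + 1 by omega]
            exact dl _
  obtain ⟨n, c, c0, cn, cS, cl⟩ := hP
  exact ⟨n, c, c0, cn, fun j => hd a ha _ (cS j), cl⟩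

/-- A chain linked at scale `ε` is refined to one linked at scale `δ`, every link being replaced
by the same number `N` of new links. -/
theorem exists_chain_refinement {X : Type*} [MetricSpace X] [LocallyConnectedSpace X]
    {ε δ : ℝ} (hε : 0 < ε) (hδ : 0 < δ) {b : X} {M : ℕ} {x : ℕ → X}
    (hx : ∀ i, SmallLinked ε (x i) (x (i + 1))) (hb : ∀ i, M ≤ i → x i = b) :
    ∃ (N : ℕ) (x' : ℕ → X), 0 < N ∧ x' 0 = x 0 ∧ (∀ m, SmallLinked δ (x' m) (x' (m + 1))) ∧
      (∀ m, N * M ≤ m → x' m = b) ∧ ∀ m, dist (x (m / N)) (x' m) ≤ ε := by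
  have H : ∀ i, ∃ (n : ℕ) (c : ℕ → X), (M ≤ i → n = 0) ∧ c 0 = x i ∧
      (∀ j, n ≤ j → c j = x (i + 1)) ∧ (∀ j, dist (x i) (c j) ≤ ε) ∧
      ∀ j, SmallLinked δ (c j) (c (j + 1)) := by
    intro i
    by_cases hi : M ≤ i
    · exact ⟨0, fun _ => b, fun _ => rfl, (hb i hi).symm, fun _ _ => (hb _ (by omega)).symm,
        fun _ => by simp [hb i hi, hε.le], fun _ => SmallLinked.refl hδ.le b⟩
    · obtain ⟨n, c, h⟩ := (hx i).exists_chain hδ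
      exact ⟨n, c, fun h => absurd h hi, h⟩
  choose n c hn c0 cn cd cl using H
  set N := 1 + ∑ i ∈ Finset.range M, n i with hN
  have hN0 : 0 < N := by omega
  have hnN : ∀ i, n i ≤ N := by
    intro i
    by_cases hi : M ≤ i
    · rw [hn i hi]; omega
    · have := Finset.single_le_sum (f := n) (fun _ _ => Nat.zero_le _)
        (Finset.mem_range.2 (not_le.1 hi))
      omega
  refine ⟨N, fun m => c (m / N) (m % N), hN0, by simp [c0], fun m => ?_, fun m hm => ?_,
    fun m => cd _ _⟩
  · have hs : c ((m + 1) / N) ((m + 1) % N) = c (m / N) (m % N + 1) := by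
      by_cases h : m % N + 1 < N
      · have hm : m + 1 = (m % N + 1) + N * (m / N) := by have := Nat.mod_add_div m N; omega
        conv_lhs => rw [hm]
        rw [Nat.add_mul_div_left _ _ hN0, Nat.add_mul_mod_self_left, Nat.div_eq_of_lt h,
          Nat.mod_eq_of_lt h, zero_add]
      · have h' : m % N + 1 = N := by have := Nat.mod_lt m hN0; omega
        have hm : m + 1 = N * (m / N + 1) := by
          have := Nat.mod_add_div m N; rw [mul_add]; omega
        conv_lhs => rw [hm]
        rw [Nat.mul_div_cancel_left _ hN0, Nat.mul_mod_right, c0, h', cn _ _ (hnN _)]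
    change SmallLinked δ (c (m / N) (m % N)) (c ((m + 1) / N) ((m + 1) % N))
    rw [hs]
    exact cl _ _
  · have hM : M ≤ m / N := (Nat.le_div_iff_mul_le hN0).2 (by rwa [mul_comm])
    change c (m / N) (m % N) = b
    rw [cn _ _ (by rw [hn _ hM]; omega), hb _ (by omega)]

/-- In a complete locally connected metric space, points in a common connected set of small
diameter are joined by a short path: the limit of step functions running along successively
refined chains. -/
theorem SmallLinked.joinedIn {X : Type*} [MetricSpace X] [CompleteSpace X]
    [LocallyConnectedSpace X] {C : ℝ} (hC : 0 < C) {a b : X} (h : SmallLinked (C / 2) a b) :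
    JoinedIn (closedBall a C) a b := by
  let H : ℕ → ℕ × (ℕ → X) → Prop := fun k p => 0 < p.1 ∧ p.2 0 = a ∧
    (∀ i, p.1 ≤ i → p.2 i = b) ∧ ∀ i, SmallLinked (C / 2 / 2 ^ k) (p.2 i) (p.2 (i + 1))
  have hε : ∀ k : ℕ, 0 < C / 2 / 2 ^ k := fun k => by positivity
  have step : ∀ k p, H k p → ∃ q, H (k + 1) q ∧ ∃ N, 0 < N ∧ q.1 = N * p.1 ∧
      ∀ m, dist (p.2 (m / N)) (q.2 m) ≤ C / 2 / 2 ^ k := by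
    rintro k ⟨M, x⟩ ⟨hM, h0, hb, hl⟩
    obtain ⟨N, x', hN, h0', hl', hb', hd⟩ := exists_chain_refinement (hε k) (hε (k + 1)) hl hb
    exact ⟨(N * M, x'), ⟨Nat.mul_pos hN hM, h0'.trans h0, hb', hl'⟩, N, hN, rfl, hd⟩
  have init : H 0 (1, fun i => if i = 0 then a else b) := by
    refine ⟨one_pos, by simp, fun i hi => by simp [show i ≠ 0 by omega], fun i => ?_⟩
    by_cases hi : i = 0
    · simpa [hi] using h
    · simpa [hi] using SmallLinked.refl (by positivity) b
  choose next hnext hrel using step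
  let s : (k : ℕ) → {p // H k p} := fun k => Nat.rec (motive := fun k => {p // H k p}) ⟨_, init⟩
    (fun k p => ⟨next k p.1 p.2, hnext k p.1 p.2⟩) k
  let M : ℕ → ℕ := fun k => (s k).1.1
  let x : ℕ → ℕ → X := fun k => (s k).1.2
  have hM : ∀ k, 0 < M k := fun k => (s k).2.1
  have hx0 : ∀ k, x k 0 = a := fun k => (s k).2.2.1
  have hxb : ∀ k i, M k ≤ i → x k i = b := fun k => (s k).2.2.2.1
  have hxl : ∀ k i, SmallLinked (C / 2 / 2 ^ k) (x k i) (x k (i + 1)) := fun k => (s k).2.2.2.2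
  have hs : ∀ k, ∃ N, 0 < N ∧ M (k + 1) = N * M k ∧
      ∀ m, dist (x k (m / N)) (x (k + 1) m) ≤ C / 2 / 2 ^ k := fun k => hrel k (s k).1 (s k).2
  let g : ℕ → ℝ → X := fun k t => x k ⌊(M k : ℝ) * t⌋₊
  have hg : ∀ t k, dist (g k t) (g (k + 1) t) ≤ C / 2 / 2 ^ k := by
    intro t k
    obtain ⟨N, hN, hMN, hd⟩ := hs k
    have hfl : ⌊(M k : ℝ) * t⌋₊ = ⌊(M (k + 1) : ℝ) * t⌋₊ / N := by
      rw [← Nat.floor_div_natCast, hMN]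
      congr 1
      have : (N : ℝ) ≠ 0 := by positivity
      push_cast
      field_simp
    simp only [g, hfl]
    exact hd _
  have hlim : ∀ t, ∃ y, Tendsto (fun k => g k t) atTop (𝓝 y) := fun t =>
    cauchySeq_tendsto_of_complete (cauchySeq_of_le_geometric_two (hg t))
  choose γ hγ using hlim
  have hdist : ∀ t k, dist (g k t) (γ t) ≤ C / 2 ^ k := fun t k =>
    dist_le_of_le_geometric_two_of_tendsto (hg t) (hγ t) k
  have hclose : ∀ (k : ℕ) (u t : ℝ), u ≤ t → t - u < 1 / M k → dist (g k u) (g k t) ≤ C / 2 ^ k := by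
    intro k u t hut htu
    have hMk : (0 : ℝ) < M k := by exact_mod_cast hM k
    have h1 : ⌊(M k : ℝ) * u⌋₊ ≤ ⌊(M k : ℝ) * t⌋₊ := Nat.floor_mono (by gcongr)
    have h2 : ⌊(M k : ℝ) * t⌋₊ < ⌊(M k : ℝ) * u⌋₊ + 2 := by
      rw [Nat.floor_lt' (by omega)]
      have h3 := Nat.lt_floor_add_one ((M k : ℝ) * u)
      rw [lt_div_iff₀ hMk] at htu
      push_cast
      linarith
    have h4 : C / 2 / 2 ^ k ≤ C / 2 ^ k := by gcongr; linarith
    rcases (by omega : ⌊(M k : ℝ) * t⌋₊ = ⌊(M k : ℝ) * u⌋₊ ∨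
      ⌊(M k : ℝ) * t⌋₊ = ⌊(M k : ℝ) * u⌋₊ + 1) with h | h
    · simp only [g, h, dist_self]; positivity
    · simp only [g, h]
      exact (hxl k _).dist_le.trans h4
  have hclose' : ∀ (k : ℕ) (u t : ℝ), |t - u| < 1 / M k → dist (g k u) (g k t) ≤ C / 2 ^ k := by
    intro k u t htu
    rcases le_total u t with h | h
    · exact hclose k u t h (by rwa [abs_of_nonneg (by linarith)] at htu)
    · rw [dist_comm]
      exact hclose k t u h (by rw [abs_sub_comm, abs_of_nonneg (by linarith)] at htu; exact htu)
  have hcont : Continuous γ := by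
    rw [Metric.continuous_iff]
    intro t ε hε'
    have ht : Tendsto (fun k : ℕ => 3 * (C * (1 / 2) ^ k)) atTop (𝓝 0) := by
      simpa using ((tendsto_pow_atTop_nhds_zero_of_lt_one (by norm_num : (0 : ℝ) ≤ 1 / 2)
        (by norm_num)).const_mul C).const_mul 3
    obtain ⟨k, hk⟩ := (ht.eventually_lt_const hε').exists
    have hk' : 3 * (C / 2 ^ k) < ε := by rwa [one_div, inv_pow, ← div_eq_mul_inv] at hk
    have hMk : (0 : ℝ) < M k := by exact_mod_cast hM k
    refine ⟨1 / M k, by positivity, fun u hu => ?_⟩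
    rw [Real.dist_eq] at hu
    have h1 := hclose' k t u hu
    have h2 := hdist t k
    have h3 := hdist u k
    calc dist (γ u) (γ t) ≤ dist (γ u) (g k u) + dist (g k u) (g k t) + dist (g k t) (γ t) :=
          dist_triangle4 _ _ _ _
      _ < ε := by linarith [dist_comm (γ u) (g k u), dist_comm (g k u) (g k t)]
  have hγ0 : γ 0 = a := by
    refine tendsto_nhds_unique (hγ 0) ?_
    simp [g, hx0]
  have hγ1 : γ 1 = b := by
    refine tendsto_nhds_unique (hγ 1) ?_
    simp [g, hxb]
  refine JoinedIn.ofLine hcont.continuousOn hγ0 hγ1 ?_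
  rintro _ ⟨t, ht, rfl⟩
  rw [mem_closedBall, dist_comm]
  rcases ht.2.lt_or_eq with h1 | rfl
  · have hg0 : g 0 t = a := by
      have : ⌊((M 0 : ℕ) : ℝ) * t⌋₊ = 0 := by
        rw [Nat.floor_eq_zero, show M 0 = 1 from rfl]
        simpa using h1
      simp only [g, this, hx0]
    simpa [hg0] using hdist t 0
  · rw [hγ1]
    linarith [h.dist_le]

theorem LocallyPathConnectedSpace.of_complete_locallyConnected {X : Type*} [MetricSpace X]
    [CompleteSpace X] [LocallyConnectedSpace X] : LocallyPathConnectedSpace X := by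
  rw [locallyPathConnectedSpace_iff_pathComponentIn_mem_nhds]
  intro x u hu hxu
  obtain ⟨C, hC, hCu⟩ := nhds_basis_closedBall.mem_iff.1 (hu.mem_nhds hxu)
  filter_upwards [eventually_smallLinked (half_pos hC) x] with y hy
  exact (hy.joinedIn hC).mono hCu

/-! ### Arcs inside paths -/

/-- `K` is a closed subset of `[0,1]` containing both endpoints, such that the path `γ` takes the
same value at the two ends of every gap of `K`: so `γ` may be replaced by a constant on each
gap. -/
structure IsShortcut {X : Type*} (γ : ℝ → X) (K : Set ℝ) : Prop where
  isClosed : IsClosed K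
  subset : K ⊆ Icc 0 1
  zero_mem : (0 : ℝ) ∈ K
  one_mem : (1 : ℝ) ∈ K
  eq_of_gap : ∀ s ∈ K, ∀ t ∈ K, s < t → (∀ r ∈ K, r ≤ s ∨ t ≤ r) → γ s = γ t

theorem IsShortcut.isCompact {X : Type*} {γ : ℝ → X} {K : Set ℝ} (h : IsShortcut γ K) :
    IsCompact K :=
  isCompact_Icc.of_isClosed_subset h.isClosed h.subset

theorem exists_isGreatest_inter_Iic {K : Set ℝ} (hK : IsCompact K) {s t : ℝ} (hs : s ∈ K)
    (hst : s ≤ t) : ∃ l, IsGreatest (K ∩ Iic t) l :=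
  (hK.inter_right isClosed_Iic).exists_isGreatest ⟨s, hs, hst⟩

theorem exists_isLeast_inter_Ici {K : Set ℝ} (hK : IsCompact K) {s t : ℝ} (hs : s ∈ K)
    (hst : t ≤ s) : ∃ l, IsLeast (K ∩ Ici t) l :=
  (hK.inter_right isClosed_Ici).exists_isLeast ⟨s, hs, hst⟩

/-- The condition of Zorn's lemma: intersections of chains of shortcuts are shortcuts. -/
theorem IsShortcut.sInter {X : Type*} [TopologicalSpace X] [T2Space X] {γ : ℝ → X}
    (hγ : Continuous γ) {c : Set (Set ℝ)} (hc : ∀ K ∈ c, IsShortcut γ K)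
    (hchain : IsChain (· ⊆ ·) c) (hne : c.Nonempty) : IsShortcut γ (⋂₀ c) := by
  refine ⟨isClosed_sInter fun K hK => (hc K hK).isClosed, ?_, fun K hK => (hc K hK).zero_mem,
    fun K hK => (hc K hK).one_mem, fun s hs t ht hst hgap => ?_⟩
  · obtain ⟨K, hK⟩ := hne
    exact (sInter_subset_of_mem hK).trans (hc K hK).subset
  by_contra hne'
  obtain ⟨U, V, hU, hV, hsU, htV, hUV⟩ := t2_separation hne'
  obtain ⟨u, hu, hsu⟩ : ∃ u, s < u ∧ Icc s u ⊆ γ ⁻¹' U :=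
    mem_nhdsGE_iff_exists_Icc_subset.1
      (mem_nhdsWithin_of_mem_nhds ((hU.preimage hγ).mem_nhds hsU))
  obtain ⟨v, hv, hvt⟩ : ∃ v, v < t ∧ Icc v t ⊆ γ ⁻¹' V :=
    mem_nhdsLE_iff_exists_Icc_subset.1
      (mem_nhdsWithin_of_mem_nhds ((hV.preimage hγ).mem_nhds htV))
  -- By compactness some member of the chain already misses the middle part of the gap.
  obtain ⟨K, hK, hKuv⟩ : ∃ K ∈ c, Disjoint K (Icc u v) := by
    by_contra! hcon
    have : (⋂ K : c, (K : Set ℝ) ∩ Icc u v).Nonempty := by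
      have : Nonempty c := hne.to_subtype
      refine IsCompact.nonempty_iInter_of_directed_nonempty_isCompact_isClosed _ ?_ ?_ ?_ ?_
      · rintro ⟨K, hK⟩ ⟨L, hL⟩
        rcases hchain.total hK hL with h | h
        · exact ⟨⟨K, hK⟩, subset_rfl, inter_subset_inter_left _ h⟩
        · exact ⟨⟨L, hL⟩, inter_subset_inter_left _ h, subset_rfl⟩
      · exact fun K => not_disjoint_iff_nonempty_inter.1 (hcon K K.2)
      · exact fun K => (hc K K.2).isCompact.inter_right isClosed_Icc
      · exact fun K => (hc K K.2).isClosed.inter isClosed_Icc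
    obtain ⟨r, hr⟩ := this
    rw [mem_iInter] at hr
    have hruv : r ∈ Icc u v := (hr ⟨_, hne.some_mem⟩).2
    rcases hgap r (fun K hK => (hr ⟨K, hK⟩).1) with h | h
    · linarith [hruv.1]
    · linarith [hruv.2]
  obtain ⟨l, ⟨hlK, hlu⟩, hl⟩ := exists_isGreatest_inter_Iic (hc K hK).isCompact (hs K hK) hu.le
  obtain ⟨r, ⟨hrK, hrv⟩, hr⟩ := exists_isLeast_inter_Ici (hc K hK).isCompact (ht K hK) hv.le
  have hlU : γ l ∈ U := hsu ⟨hl ⟨hs K hK, hu.le⟩, hlu⟩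
  have hrV : γ r ∈ V := hvt ⟨hrv, hr ⟨ht K hK, hv.le⟩⟩
  have huv : u < v := by
    by_contra! h
    rcases le_total u t with hut | hut
    · exact disjoint_left.1 hUV (hsu ⟨hu.le, le_rfl⟩) (hvt ⟨h, hut⟩)
    · exact disjoint_left.1 hUV (hsu ⟨hst.le, hut⟩) htV
  refine disjoint_left.1 hUV hlU (((hc K hK).eq_of_gap l hlK r hrK ?_ fun k hk => ?_) ▸ hrV)
  · rw [mem_Iic] at hlu; rw [mem_Ici] at hrv; linarith
  · rcases le_or_gt k u with h | h
    · exact Or.inl (hl ⟨hk, h⟩)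
    · rcases le_or_gt v k with h' | h'
      · exact Or.inr (hr ⟨hk, h'⟩)
      · exact absurd ⟨h.le, h'.le⟩ (disjoint_left.1 hKuv hk)

/-- A minimal set of the kind described by `IsShortcut`: distinct points with the same image are
the ends of a gap. -/
theorem exists_minimal_isShortcut {X : Type*} [TopologicalSpace X] [T2Space X] {γ : ℝ → X}
    (hγ : Continuous γ) : ∃ K, IsShortcut γ K ∧
      ∀ s ∈ K, ∀ t ∈ K, s < t → γ s = γ t → ∀ r ∈ K, r ≤ s ∨ t ≤ r := by
  have h01 : IsShortcut γ (Icc 0 1) := by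
    refine ⟨isClosed_Icc, subset_rfl, by simp, by simp, fun s hs t ht hst hgap => ?_⟩
    rcases hgap ((s + t) / 2) ⟨by linarith [hs.1, ht.1], by linarith [hs.2, ht.2]⟩ with h | h <;>
      linarith
  obtain ⟨K, -, hK⟩ := zorn_superset_nonempty {K | IsShortcut γ K}
    (fun c hc hchain hne => ⟨⋂₀ c, .sInter hγ hc hchain hne, fun _ h => sInter_subset_of_mem h⟩)
    _ h01
  refine ⟨K, hK.prop, fun s hs t ht hst heq r hr => ?_⟩
  have hK' := hK.prop
  rw [mem_ofPred_eq] at hK'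
  have hcut : IsShortcut γ (K \ Ioo s t) := by
    refine ⟨hK'.isClosed.sdiff isOpen_Ioo, sdiff_subset.trans hK'.subset,
      ⟨hK'.zero_mem, fun h => by linarith [h.1, (hK'.subset hs).1]⟩,
      ⟨hK'.one_mem, fun h => by linarith [h.2, (hK'.subset ht).2]⟩, ?_⟩
    rintro x ⟨hx, hxs⟩ y ⟨hy, hys⟩ hxy hgap
    by_cases hg : ∀ k ∈ K, k ≤ x ∨ y ≤ k
    · exact hK'.eq_of_gap x hx y hy hxy hg
    -- Otherwise the gap is exactly the one that was cut out.
    push Not at hg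
    obtain ⟨k, hk, hxk, hky⟩ := hg
    have hkst : k ∈ Ioo s t := by
      by_contra h
      rcases hgap k ⟨hk, h⟩ with h | h <;> linarith
    have h1 := hgap s ⟨hs, fun h => lt_irrefl _ h.1⟩
    have h2 := hgap t ⟨ht, fun h => lt_irrefl _ h.2⟩
    have hsx : s ≤ x := h1.resolve_right (by linarith [hkst.1])
    have hyt : y ≤ t := h2.resolve_left (by linarith [hkst.2])
    have hxs' : x = s := le_antisymm (not_lt.1 fun h => hxs ⟨h, by linarith [hkst.2]⟩) hsx
    have hyt' : y = t := le_antisymm hyt (not_lt.1 fun h => hys ⟨by linarith [hkst.1], h⟩)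
    rw [hxs', hyt', heq]
  by_contra! h
  exact (hK.le_of_le hcut sdiff_subset hr).2 ⟨h.1, h.2⟩

/-- Inside a path there is a monotone path, one whose fibres are order-convex. -/
theorem exists_monotone_path {X : Type*} [MetricSpace X] {γ : ℝ → X} (hγ : Continuous γ) :
    ∃ δ : unitInterval → X, Continuous δ ∧ δ 0 = γ 0 ∧ δ 1 = γ 1 ∧ range δ ⊆ γ '' Icc 0 1 ∧
      ∀ r s t, r ≤ s → s ≤ t → δ r = δ t → δ s = δ r := by
  obtain ⟨K, hK, hmin⟩ := exists_minimal_isShortcut hγ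
  have hl : ∀ t : unitInterval, ∃ l, IsGreatest (K ∩ Iic (t : ℝ)) l := fun t =>
    exists_isGreatest_inter_Iic hK.isCompact hK.zero_mem t.2.1
  choose l hl using hl
  have hlK : ∀ t, l t ∈ K := fun t => (hl t).1.1
  have hlt : ∀ t, l t ≤ t := fun t => (hl t).1.2
  have hlmax : ∀ t : unitInterval, ∀ k ∈ K, k ≤ t → k ≤ l t := fun t k hk hkt => (hl t).2 ⟨hk, hkt⟩
  have hmono : ∀ s t, s ≤ t → l s ≤ l t := fun s t hst => hlmax t _ (hlK s) ((hlt s).trans hst)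
  have hunif : UniformContinuousOn γ (Icc 0 1) :=
    isCompact_Icc.uniformContinuousOn_of_continuous hγ.continuousOn
  rw [Metric.uniformContinuousOn_iff] at hunif
  have hclose : ∀ ε > 0, ∃ d > 0, ∀ s t : unitInterval, s ≤ t → (t : ℝ) - s < d →
      dist (γ (l s)) (γ (l t)) < ε := by
    intro ε hε
    obtain ⟨d, hd, h⟩ := hunif ε hε
    refine ⟨d, hd, fun s t hst hd' => ?_⟩
    obtain ⟨r, ⟨hrK, hsr⟩, hr⟩ := exists_isLeast_inter_Ici hK.isCompact hK.one_mem s.2.2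
    rw [mem_Ici] at hsr
    have hlr : γ (l s) = γ r := by
      rcases ((hlt s).trans hsr).eq_or_lt with h | h
      · rw [h]
      · refine hK.eq_of_gap _ (hlK s) _ hrK h fun k hk => ?_
        rcases le_total k s with h | h
        · exact Or.inl (hlmax s k hk h)
        · exact Or.inr (hr ⟨hk, h⟩)
    by_cases hrt : r ≤ t
    · rw [hlr]
      refine h _ (hK.subset hrK) _ (hK.subset (hlK t)) ?_
      rw [dist_comm, Real.dist_eq, abs_of_nonneg (by linarith [hlmax t r hrK hrt])]
      linarith [hlt t]
    · have : l t ≤ l s := by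
        refine hlmax s _ (hlK t) (not_lt.1 fun h => hrt ((hr ⟨hlK t, h.le⟩).trans (hlt t)))
      rw [le_antisymm this (hmono s t hst), dist_self]
      exact hε
  refine ⟨fun t => γ (l t), ?_, ?_, ?_, ?_, ?_⟩
  · rw [Metric.continuous_iff]
    intro t ε hε
    obtain ⟨d, hd, h⟩ := hclose ε hε
    refine ⟨d, hd, fun s hs => ?_⟩
    rw [Subtype.dist_eq, Real.dist_eq, abs_lt] at hs
    rcases le_total s t with hst | hst
    · exact h s t hst (by linarith)
    · rw [dist_comm]
      exact h t s hst (by linarith)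
  · exact congrArg γ (le_antisymm (hlt 0) (hlmax 0 0 hK.zero_mem le_rfl))
  · exact congrArg γ (le_antisymm (hlt 1) (hlmax 1 1 hK.one_mem le_rfl))
  · rintro _ ⟨t, rfl⟩
    exact ⟨l t, hK.subset (hlK t), rfl⟩
  · intro r s t hrs hst heq
    dsimp only at heq ⊢
    rcases (hmono r t (hrs.trans hst)).eq_or_lt with h | h
    · rw [le_antisymm ((hmono s t hst).trans h.ge) (hmono r s hrs)]
    · rcases hmin _ (hlK r) _ (hlK t) h heq _ (hlK s) with h' | h'
      · rw [le_antisymm h' (hmono r s hrs)]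
      · rw [le_antisymm (hmono s t hst) h', heq]

/-- A monotone path admits a real-valued parameter with the same fibres. The parameter measures
how closely the initial segments of the path approach the points of a dense sequence. -/
theorem exists_parameter_of_monotone_path {X : Type*} [MetricSpace X] {δ : unitInterval → X}
    (hδ : Continuous δ) (hmono : ∀ r s t, r ≤ s → s ≤ t → δ r = δ t → δ s = δ r) :
    ∃ φ : unitInterval → ℝ, Continuous φ ∧ Monotone φ ∧ ∀ s t, φ s = φ t ↔ δ s = δ t := by
  let c : ℕ → X := fun n => δ (TopologicalSpace.denseSeq unitInterval n)
  let m : ℕ → unitInterval → ℝ := fun n t => sInf ((fun r => dist (δ (r ⊓ t)) (c n)) '' univ)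
  have hm_le : ∀ n s t, s ≤ t → m n t ≤ dist (δ s) (c n) := fun n s t hst =>
    csInf_le ⟨0, by rintro _ ⟨r, -, rfl⟩; exact dist_nonneg⟩
      ⟨s, mem_univ _, by simp only [inf_eq_left.2 hst]⟩
  have hle_m : ∀ n t b, (∀ r ≤ t, b ≤ dist (δ r) (c n)) → b ≤ m n t := fun n t b h =>
    le_csInf (univ_nonempty.image _) (by rintro _ ⟨r, -, rfl⟩; exact h _ inf_le_right)
  have hm0 : ∀ n t, 0 ≤ m n t := fun n t => hle_m n t 0 fun _ _ => dist_nonneg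
  have hanti : ∀ n s t, s ≤ t → m n t ≤ m n s := fun n s t hst =>
    hle_m n s _ fun r hr => hm_le n r t (hr.trans hst)
  have hmc : ∀ n, Continuous (m n) := fun n =>
    isCompact_univ.continuous_sInf (f := fun t r => dist (δ (r ⊓ t)) (c n))
      (show Continuous fun p : unitInterval × unitInterval => dist (δ (p.2 ⊓ p.1)) (c n) by
        fun_prop)
  let D := diam (range δ)
  have hmD : ∀ n t, m n t ≤ D := fun n t => (hm_le n t t le_rfl).trans
    (dist_le_diam_of_mem (isCompact_range hδ).isBounded (mem_range_self _) (mem_range_self _))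
  have hsD : Summable fun n : ℕ => (1 / 2 : ℝ) ^ n * D := summable_geometric_two.mul_right D
  have hbound : ∀ n t, ‖(1 / 2 : ℝ) ^ n * m n t‖ ≤ (1 / 2 : ℝ) ^ n * D := fun n t => by
    rw [Real.norm_of_nonneg (mul_nonneg (by positivity) (hm0 n t))]
    exact mul_le_mul_of_nonneg_left (hmD n t) (by positivity)
  have hs : ∀ t, Summable fun n : ℕ => (1 / 2 : ℝ) ^ n * m n t := fun t =>
    .of_norm_bounded hsD fun n => hbound n t
  have hterm : ∀ s t, s ≤ t → ∀ n : ℕ, (1 / 2 : ℝ) ^ n * m n t ≤ (1 / 2 : ℝ) ^ n * m n s :=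
    fun s t hst n => mul_le_mul_of_nonneg_left (hanti n s t hst) (by positivity)
  let φ : unitInterval → ℝ := fun t => -∑' n : ℕ, (1 / 2 : ℝ) ^ n * m n t
  have hφ : Monotone φ := fun s t hst =>
    neg_le_neg ((hs t).tsum_le_tsum (hterm s t hst) (hs s))
  have hlt : ∀ s t, s ≤ t → δ s ≠ δ t → φ s < φ t := by
    intro s t hst hne
    have hnot : δ t ∉ δ '' Iic s := by
      rintro ⟨r, hr, hrt⟩
      exact hne ((hmono r s t hr hst hrt).trans hrt)
    have hcl : IsClosed (δ '' Iic s) := (isClosed_Iic.isCompact.image hδ).isClosed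
    obtain ⟨ε, hε, hball⟩ := Metric.mem_nhds_iff.1 (hcl.isOpen_compl.mem_nhds hnot)
    obtain ⟨n, hn⟩ : ∃ n, dist (δ t) (c n) < ε / 2 := by
      obtain ⟨n, hq⟩ := (TopologicalSpace.denseRange_denseSeq unitInterval).exists_mem_open
        (isOpen_ball.preimage hδ) ⟨t, mem_ball_self (x := δ t) (half_pos hε)⟩
      exact ⟨n, by rw [dist_comm]; exact mem_ball.1 hq⟩
    have h1 : m n t < ε / 2 := (hm_le n t t le_rfl).trans_lt hn
    have h2 : ε / 2 ≤ m n s := hle_m n s _ fun r hr => by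
      have h3 : ε ≤ dist (δ r) (δ t) := not_lt.1 fun h => hball h ⟨r, hr, rfl⟩
      have h4 := dist_triangle_right (δ r) (δ t) (c n)
      linarith
    exact neg_lt_neg (Summable.tsum_lt_tsum (i := n) (hterm s t hst)
      (mul_lt_mul_of_pos_left (h1.trans_le h2) (by positivity)) (hs t) (hs s))
  have heq : ∀ s t, s ≤ t → δ s = δ t → φ s = φ t := by
    intro s t hst h
    have : ∀ r, δ (r ⊓ s) = δ (r ⊓ t) := by
      intro r
      rcases le_total r s with hr | hr
      · rw [inf_eq_left.2 hr, inf_eq_left.2 (hr.trans hst)]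
      · rw [inf_eq_right.2 hr]
        exact (hmono s _ t (le_inf hr hst) inf_le_right h).symm
    simp only [φ, m, this]
  refine ⟨φ, (continuous_tsum (fun n => (hmc n).const_mul _) hsD hbound).neg, hφ,
    fun s t => ⟨fun h => ?_, fun h => ?_⟩⟩
  · by_contra hne
    rcases le_total s t with hst | hst
    · exact (hlt s t hst hne).ne h
    · exact (hlt t s hst (Ne.symm hne)).ne h.symm
  · rcases le_total s t with hst | hst
    · exact heq s t hst h
    · exact (heq t s hst h.symm).symm

/-- Two distinct points joined by a path in `F` are the ends of an arc in `F`. -/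
theorem JoinedIn.exists_injOn {X : Type*} [MetricSpace X] {F : Set X} {x y : X}
    (h : JoinedIn F x y) (hxy : x ≠ y) :
    ∃ α : ℝ → X, Continuous α ∧ InjOn α (Icc 0 1) ∧ α 0 = x ∧ α 1 = y ∧ α '' Icc 0 1 ⊆ F := by
  obtain ⟨p, hp⟩ := h
  obtain ⟨δ, hδ, hδ0, hδ1, hδF, hmono⟩ := exists_monotone_path p.extend.continuous
  obtain ⟨φ, hφ, hφm, hφδ⟩ := exists_parameter_of_monotone_path hδ hmono
  simp only [Path.extend_zero, Path.extend_one] at hδ0 hδ1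
  have hpos : 0 < φ 1 - φ 0 := by
    refine sub_pos.2 ((hφm (zero_le_one' unitInterval)).lt_of_ne fun h => hxy ?_)
    rw [← hδ0, ← hδ1, ← hφδ, h]
  let ψ : C(unitInterval, unitInterval) :=
    ⟨fun t => ⟨(φ t - φ 0) / (φ 1 - φ 0),
      div_nonneg (sub_nonneg.2 (hφm t.2.1)) hpos.le,
      (div_le_one hpos).2 (sub_le_sub_right (hφm t.2.2) _)⟩, by fun_prop⟩
  have hψ0 : ψ 0 = 0 := Subtype.ext (by simp [ψ])
  have hψ1 : ψ 1 = 1 := Subtype.ext (by simp [ψ, hpos.ne'])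
  have hψδ : ∀ s t, ψ s = ψ t ↔ δ s = δ t := by
    intro s t
    rw [← hφδ, Subtype.ext_iff]
    simp only [ψ, ContinuousMap.coe_mk]
    rw [div_left_inj' hpos.ne', sub_left_inj]
  have hsurj : Function.Surjective ψ := fun t =>
    mem_range_of_exists_le_of_exists_ge ψ.continuous ⟨0, by rw [hψ0]; exact t.2.1⟩
      ⟨1, by rw [hψ1]; exact t.2.2⟩
  have hq : IsQuotientMap ψ := .of_surjective_continuous hsurj ψ.continuous
  let β : C(unitInterval, X) := hq.lift ⟨δ, hδ⟩ fun s t hst => (hψδ s t).1 hst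
  have hβ : ∀ t, β (ψ t) = δ t := fun t =>
    DFunLike.congr_fun (hq.lift_comp ⟨δ, hδ⟩ fun s t hst => (hψδ s t).1 hst) t
  have hinj : Function.Injective β := by
    intro a b hab
    obtain ⟨s, rfl⟩ := hsurj a
    obtain ⟨t, rfl⟩ := hsurj b
    rwa [hβ, hβ, ← hψδ] at hab
  refine ⟨IccExtend zero_le_one β, β.continuous.Icc_extend', fun s hs t ht hst => ?_, ?_, ?_, ?_⟩
  · rw [IccExtend_of_mem _ _ hs, IccExtend_of_mem _ _ ht] at hst
    exact congrArg Subtype.val (hinj hst)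
  · rw [IccExtend_left, ← hδ0, ← hβ, hψ0]; rfl
  · rw [IccExtend_right, ← hδ1, ← hβ, hψ1]; rfl
  · rintro _ ⟨t, ht, rfl⟩
    rw [IccExtend_of_mem _ _ ht]
    obtain ⟨s, hs⟩ := hsurj ⟨t, ht⟩
    rw [← hs, hβ]
    obtain ⟨u, hu, hus⟩ := hδF ⟨s, rfl⟩
    rw [← hus, Path.extend_apply _ hu]
    exact hp _

/-! ### Simple closed curves from pairs of arcs -/

/-- Two arcs with common endpoints, one of which has its interior disjoint from the other, form a
simple closed curve. -/
theorem exists_isSimpleClosedCurve_of_arcs {X : Type*} [TopologicalSpace X] [T2Space X]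
    {α β : ℝ → X} (hα : Continuous α) (hβ : Continuous β) (hαi : InjOn α (Icc 0 1))
    (hβi : InjOn β (Icc 0 1)) (h0 : α 0 = β 0) (h1 : α 1 = β 1)
    (hd : ∀ s ∈ Ioo (0 : ℝ) 1, α s ∉ β '' Icc 0 1) : ∃ S : Set X, IsSimpleClosedCurve S := by
  have : Fact ((0 : ℝ) < 2) := ⟨two_pos⟩
  let F : ℝ → X := fun t => if t ≤ 1 then α t else β (2 - t)
  have hF : Continuous F := by
    refine hα.if_le (by fun_prop) continuous_id continuous_const ?_
    rintro t rfl
    norm_num [h1]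
  have hcross : ∀ s t : ℝ, 0 ≤ s → s ≤ 1 → 1 < t → t < 2 → α s ≠ β (2 - t) := by
    intro s t hs0 hs1 ht1 ht2 h
    have ht : 2 - t ∈ Icc (0 : ℝ) 1 := ⟨by linarith, by linarith⟩
    rcases hs0.eq_or_lt with rfl | hs0
    · have := hβi ⟨le_rfl, zero_le_one⟩ ht (h0 ▸ h)
      linarith
    · rcases hs1.eq_or_lt with rfl | hs1
      · have := hβi ⟨zero_le_one, le_rfl⟩ ht (h1 ▸ h)
        linarith
      · exact hd s ⟨hs0, hs1⟩ ⟨_, ht, h.symm⟩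
  have hinj : ∀ s ∈ Ico (0 : ℝ) 2, ∀ t ∈ Ico (0 : ℝ) 2, F s = F t → s = t := by
    intro s hs t ht h
    by_cases hs1 : s ≤ 1 <;> by_cases ht1 : t ≤ 1 <;> simp only [F, hs1, ht1, if_true, if_false] at h
    · exact hαi ⟨hs.1, hs1⟩ ⟨ht.1, ht1⟩ h
    · exact absurd h (hcross s t hs.1 hs1 (not_le.1 ht1) ht.2)
    · exact absurd h.symm (hcross t s ht.1 ht1 (not_le.1 hs1) hs.2)
    · have := hβi (x₁ := 2 - s) (x₂ := 2 - t) ⟨by linarith [hs.2], by linarith⟩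
        ⟨by linarith [ht.2], by linarith⟩ h
      linarith
  let G : AddCircle (2 : ℝ) → X := AddCircle.liftIco 2 0 F
  have hG : Continuous G := AddCircle.liftIco_zero_continuous (by simp [F, h0]) hF.continuousOn
  have hGi : Function.Injective G := by
    have hrep : ∀ a : AddCircle (2 : ℝ), ∃ s ∈ Ico (0 : ℝ) 2, (s : AddCircle (2 : ℝ)) = a := by
      intro a
      have ha : a ∈ ((↑) : ℝ → AddCircle (2 : ℝ)) '' Ico (0 : ℝ) (0 + 2) := by
        rw [AddCircle.coe_image_Ico_eq]; trivial
      simpa using ha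
    intro a b hab
    obtain ⟨s, hs, rfl⟩ := hrep a
    obtain ⟨t, ht, rfl⟩ := hrep b
    simp only [G] at hab
    rw [AddCircle.liftIco_zero_coe_apply hs, AddCircle.liftIco_zero_coe_apply ht] at hab
    rw [hinj s hs t ht hab]
  exact ⟨range G, ⟨(AddCircle.homeomorphCircle two_ne_zero).symm.trans
    (hG.isClosedEmbedding hGi).isEmbedding.toHomeomorph⟩⟩

/-! ### Betweenness -/

/-- `y` lies between `x` and `z`: every connected set containing `x` and `z` contains `y`. In a
dendrite this says that `y` lies on the arc from `x` to `z`. -/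
def Between {X : Type*} [TopologicalSpace X] (x y z : X) : Prop :=
  ∀ C : Set X, IsPreconnected C → x ∈ C → z ∈ C → y ∈ C

namespace Between

variable {X : Type*} [TopologicalSpace X] {x y z a b c : X}

theorem left (x z : X) : Between x x z := fun _ _ h _ => h

theorem right (x z : X) : Between x z z := fun _ _ _ h => h

theorem symm (h : Between x y z) : Between z y x := fun C hC hz hx => h C hC hx hz

theorem eq_of_self (h : Between x y x) : y = x :=
  h {x} isPreconnected_singleton rfl rfl

theorem trans (h : Between x a b) (h' : Between x b c) : Between x a c :=
  fun C hC hx hc => h C hC hx (h' C hC hx hc)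

/-- A point between `p` and `q` is between any third point `w` and one of `p`, `q`. -/
theorem or_of_between {p q : X} (h : Between p z q) (w : X) : Between p z w ∨ Between q z w := by
  by_contra! hcon
  simp only [Between, not_forall] at hcon
  obtain ⟨⟨C, hC, hpC, hwC, hzC⟩, D, hD, hqD, hwD, hzD⟩ := hcon
  rcases h (C ∪ D) (hC.union w hwC hwD hD) (Or.inl hpC) (Or.inr hqD) with h | h
  exacts [hzC h, hzD h]

/-- If `y` is not between `x` and `z`, then a path joins `x` to `z` off `y`. -/
theorem joinedIn_compl_of_not [T1Space X] [LocallyPathConnectedSpace X] (h : ¬ Between x y z) :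
    JoinedIn {y}ᶜ x z := by
  simp only [Between, not_forall] at h
  obtain ⟨C, hC, hx, hz, hy⟩ := h
  have hCs : C ⊆ {y}ᶜ := by rintro w hw rfl; exact hy hw
  have hopen : IsOpen (connectedComponentIn {y}ᶜ x) := isOpen_compl_singleton.connectedComponentIn
  have hpath : IsPathConnected (connectedComponentIn {y}ᶜ x) :=
    hopen.isConnected_iff_isPathConnected.1 (isConnected_connectedComponentIn_iff.2 (hCs hx))
  exact (hpath.joinedIn x (mem_connectedComponentIn (hCs hx)) z
    (hC.subset_connectedComponentIn hx hCs hz)).mono (connectedComponentIn_subset _ _)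

end Between

/-- Without simple closed curves, every connected set containing the ends of an arc contains the
arc: a detour around an interior point would close up to a simple closed curve. -/
theorem between_of_injOn {X : Type*} [MetricSpace X] [LocallyPathConnectedSpace X]
    (hX : ∀ S : Set X, ¬ IsSimpleClosedCurve S) {α : ℝ → X} (hα : Continuous α) {u v t : ℝ}
    (hαi : InjOn α (Icc u v)) (ht : t ∈ Icc u v) : Between (α u) (α t) (α v) := by
  by_contra hcon
  have htu : t ≠ u := by rintro rfl; exact hcon (Between.left _ _)
  have htv : t ≠ v := by rintro rfl; exact hcon (Between.right _ _)
  have hut : u < t := ht.1.lt_of_ne' htu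
  have htv : t < v := ht.2.lt_of_ne htv
  have hu : u ∈ Icc u v := ⟨le_rfl, by linarith⟩
  have hv : v ∈ Icc u v := ⟨by linarith, le_rfl⟩
  have huv : α u ≠ α v := fun h => by linarith [hαi hu hv h]
  obtain ⟨β, hβ, hβi, hβ0, hβ1, hβt⟩ := (Between.joinedIn_compl_of_not hcon).exists_injOn huv
  have hB : IsClosed (α ⁻¹' (β '' Icc 0 1)) := (isCompact_Icc.image hβ).isClosed.preimage hα
  have htB : α t ∉ β '' Icc 0 1 := fun h => hβt h rfl
  -- `[p, q]` is the largest interval around `t` whose interior is mapped off the detour `β`.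
  obtain ⟨p, ⟨⟨hup, hpt⟩, P, hP, hPp⟩, hpmax⟩ :=
    ((isCompact_Icc (a := u) (b := t)).inter_right hB).exists_isGreatest
      ⟨u, ⟨le_rfl, hut.le⟩, 0, by simp, hβ0⟩
  obtain ⟨q, ⟨⟨htq, hqv⟩, Q, hQ, hQq⟩, hqmin⟩ :=
    ((isCompact_Icc (a := t) (b := v)).inter_right hB).exists_isLeast
      ⟨v, ⟨htv.le, le_rfl⟩, 1, by simp, hβ1⟩
  have hpt' : p < t := hpt.lt_of_ne fun h => htB ⟨P, hP, by rw [hPp, h]⟩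
  have htq' : t < q := htq.lt_of_ne' fun h => htB ⟨Q, hQ, by rw [hQq, h]⟩
  have hPQ : Q - P ≠ 0 := fun h => by
    have hαpq : α p = α q := by rw [← hPp, ← hQq, sub_eq_zero.1 h]
    linarith [hαi ⟨hup, by linarith⟩ ⟨by linarith, hqv⟩ hαpq]
  have hpq : 0 < q - p := by linarith
  have hmem : ∀ r ∈ Icc (0 : ℝ) 1, p + (q - p) * r ∈ Icc p q := fun r hr =>
    ⟨by nlinarith [hr.1], by nlinarith [hr.2]⟩
  have hmem' : ∀ r ∈ Icc (0 : ℝ) 1, P + (Q - P) * r ∈ Icc (0 : ℝ) 1 := fun r hr =>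
    ⟨by nlinarith [hr.1, hr.2, hP.1, hQ.1], by nlinarith [hr.1, hr.2, hP.2, hQ.2]⟩
  obtain ⟨S, hS⟩ := exists_isSimpleClosedCurve_of_arcs
    (α := fun r => α (p + (q - p) * r)) (β := fun r => β (P + (Q - P) * r))
    (by fun_prop) (by fun_prop)
    (fun r hr r' hr' h => by
      have := hαi ⟨hup.trans (hmem r hr).1, (hmem r hr).2.trans hqv⟩
        ⟨hup.trans (hmem r' hr').1, (hmem r' hr').2.trans hqv⟩ h
      exact mul_left_cancel₀ hpq.ne' (add_left_cancel this))
    (fun r hr r' hr' h => mul_left_cancel₀ hPQ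
      (add_left_cancel (hβi (hmem' r hr) (hmem' r' hr') h)))
    (by simp [hPp]) (by simp [hQq]) (by
      rintro r hr ⟨r', hr', h⟩
      have h1 : p < p + (q - p) * r := by nlinarith [hr.1]
      have h2 : p + (q - p) * r < q := by nlinarith [hr.2]
      have h3 : α (p + (q - p) * r) ∈ β '' Icc 0 1 := ⟨_, hmem' r' hr', h⟩
      rcases le_total (p + (q - p) * r) t with h4 | h4
      · exact h1.not_ge (hpmax ⟨⟨by linarith, h4⟩, h3⟩)
      · exact h2.not_ge (hqmin ⟨⟨h4, by linarith⟩, h3⟩))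
  exact hX S hS

/-! ### The rooted betweenness order -/

theorem exists_arc {X : Type*} [MetricSpace X] [ConnectedSpace X] [LocallyPathConnectedSpace X]
    {x y : X} (hxy : x ≠ y) :
    ∃ α : ℝ → X, Continuous α ∧ InjOn α (Icc 0 1) ∧ α 0 = x ∧ α 1 = y := by
  have : PathConnectedSpace X := .of_locallyPathConnectedSpace
  obtain ⟨α, h, hi, h0, h1, -⟩ :=
    (joinedIn_univ.2 (PathConnectedSpace.joined x y)).exists_injOn hxy
  exact ⟨α, h, hi, h0, h1⟩

namespace Between

theorem antisymm {X : Type*} [MetricSpace X] [ConnectedSpace X]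
    [LocallyPathConnectedSpace X] {x a b : X}
    (h : Between x a b) (h' : Between x b a) : a = b := by
  by_cases hxb : x = b
  · subst hxb
    exact h.eq_of_self
  obtain ⟨α, hα, hαi, rfl, rfl⟩ := exists_arc hxb
  obtain ⟨t, ht, rfl⟩ := h (α '' Icc 0 1) (isPreconnected_Icc.image _ hα.continuousOn)
    ⟨0, by simp, rfl⟩ ⟨1, by simp, rfl⟩
  obtain ⟨s, hs, hs1⟩ := h' (α '' Icc 0 t) (isPreconnected_Icc.image _ hα.continuousOn)
    ⟨0, ⟨le_rfl, ht.1⟩, rfl⟩ ⟨t, ⟨ht.1, le_rfl⟩, rfl⟩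
  have : s = 1 := hαi ⟨hs.1, hs.2.trans ht.2⟩ (by simp) hs1
  rw [le_antisymm ht.2 (this ▸ hs.2)]

/-- If `α 0` lies between `x` and `α 1`, the arc `α` leads monotonically away from `x`. -/
theorem arc_mono {X : Type*} [MetricSpace X] [LocallyPathConnectedSpace X]
    (hX : ∀ S : Set X, ¬ IsSimpleClosedCurve S) {x : X} {α : ℝ → X} (hα : Continuous α)
    (hαi : InjOn α (Icc 0 1)) (h : Between x (α 0) (α 1)) {s t : ℝ} (hs : 0 ≤ s) (hst : s ≤ t)
    (ht : t ≤ 1) : Between x (α s) (α t) := by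
  intro C hC hxC htC
  rcases hst.eq_or_lt with rfl | hst
  · exact htC
  have hD : IsPreconnected (C ∪ α '' Icc t 1) :=
    hC.union _ htC ⟨t, ⟨le_rfl, ht⟩, rfl⟩ (isPreconnected_Icc.image _ hα.continuousOn)
  have h1 : α 1 ∈ C ∪ α '' Icc t 1 := Or.inr ⟨1, ⟨ht, le_rfl⟩, rfl⟩
  rcases between_of_injOn hX hα hαi ⟨hs, hst.le.trans ht⟩ _ hD (h _ hD (Or.inl hxC) h1) h1
    with h2 | ⟨r, hr, hrs⟩
  · exact h2
  · have := hαi ⟨hs.trans (hst.le.trans hr.1), hr.2⟩ ⟨hs, hst.le.trans ht⟩ hrs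
    linarith [hr.1]

/-- What lies on the way from `y` to a point beyond `y` is itself beyond `y`. -/
theorem of_between_right {X : Type*} [MetricSpace X] [ConnectedSpace X]
    [LocallyPathConnectedSpace X]
    (hX : ∀ S : Set X, ¬ IsSimpleClosedCurve S) {x y z w : X} (h : Between x y z)
    (h' : Between y w z) : Between x y w := by
  by_cases hyz : y = z
  · subst hyz
    rw [h'.eq_of_self]
    exact right _ _
  obtain ⟨α, hα, hαi, rfl, rfl⟩ := exists_arc hyz
  obtain ⟨t, ht, rfl⟩ := h' (α '' Icc 0 1) (isPreconnected_Icc.image _ hα.continuousOn)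
    ⟨0, by simp, rfl⟩ ⟨1, by simp, rfl⟩
  exact arc_mono hX hα hαi h le_rfl ht.1 ht.2

/-- Let `p ≠ q` lie in this order on the way from `a` to `b`. If `w` lies beyond `p` as seen from
`b` and `w'` lies beyond `q` as seen from `a`, then `p` lies between `w` and `w'`. -/
theorem of_beyond {X : Type*} [MetricSpace X] [ConnectedSpace X]
    [LocallyPathConnectedSpace X]
    (hX : ∀ S : Set X, ¬ IsSimpleClosedCurve S) {a b p q w w' : X} (hpq : p ≠ q)
    (hap : Between a p q) (hbq : Between b q p) (hw : Between b p w) (hw' : Between a q w') :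
    Between w p w' := by
  have h1 : ¬ Between q p w' := fun h =>
    hpq (antisymm hap (of_between_right hX hw' h))
  have h2 : ¬ Between q p b := fun h => hpq (antisymm h.symm hbq)
  simp only [Between, not_forall] at h1 h2
  obtain ⟨C, hC, hqC, hwC, hpC⟩ := h1
  obtain ⟨D, hD, hqD, hbD, hpD⟩ := h2
  intro E hE hwE hwE'
  have hU : IsPreconnected (E ∪ (C ∪ D)) :=
    hE.union w' hwE' (Or.inl hwC) (hC.union q hqC hqD hD)
  rcases hw _ hU (Or.inr (Or.inr hbD)) (Or.inl hwE) with h | h | h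
  exacts [h, absurd h hpC, absurd h hpD]

/-- The order "`y` lies between `x` and `z`" rooted at `x` is closed. -/
theorem isClosed_setOf {X : Type*} [MetricSpace X] [LocallyPathConnectedSpace X] (x : X) :
    IsClosed {p : X × X | Between x p.1 p.2} := by
  rw [← isOpen_compl_iff, isOpen_iff_mem_nhds]
  rintro ⟨z, w⟩ hzw
  obtain ⟨γ, hγ⟩ := joinedIn_compl_of_not hzw
  have hzK : z ∉ range γ := by
    rintro ⟨t, ht⟩
    exact hγ t ht
  have hwK : w ∈ range γ := ⟨1, γ.target⟩
  have hne : z ≠ w := fun h => hzK (h ▸ hwK)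
  obtain ⟨U, V, hU, hV, hzU, hwV, hUV⟩ := t2_separation hne
  have hK : IsClosed (range γ) := (isCompact_range γ.continuous).isClosed
  filter_upwards [prod_mem_nhds ((hU.inter hK.isOpen_compl).mem_nhds ⟨hzU, hzK⟩)
    (connectedComponentIn_mem_nhds (hV.mem_nhds hwV))]
  rintro ⟨z', w'⟩ ⟨⟨hz'U, hz'K⟩, hw'⟩ hbet
  have hwC : w ∈ connectedComponentIn V w := mem_connectedComponentIn hwV
  rcases hbet (range γ ∪ connectedComponentIn V w)
    ((isPreconnected_range γ.continuous).union w hwK hwC isPreconnected_connectedComponentIn)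
    (Or.inl ⟨0, γ.source⟩) (Or.inr hw') with h | h
  · exact hz'K h
  · exact disjoint_left.1 hUV hz'U (connectedComponentIn_subset _ _ h)

end Between

/-! ### Fixed points and expanding arcs -/

/-- If `g` moves `y` away from `x`, then `g` has a fixed point beyond `y`: a maximal point among
those beyond `y` which are not moved towards `x` is fixed. -/
theorem exists_fixedPoint_beyond {X : Type*} [MetricSpace X] [ConnectedSpace X]
    [LocallyPathConnectedSpace X] [CompactSpace X] (hX : ∀ S : Set X, ¬ IsSimpleClosedCurve S)
    {g : X → X} (hg : Continuous g) {x y : X} (h : Between x y (g y)) :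
    ∃ w, g w = w ∧ Between x y w := by
  let S : Set X := {z | Between x y z ∧ Between x z (g z)}
  have hup : ∀ a, IsClosed {z | Between x a z} := fun a =>
    (Between.isClosed_setOf x).preimage (by fun_prop : Continuous fun z : X => (a, z))
  have hS : IsClosed S := (hup y).inter
    ((Between.isClosed_setOf x).preimage (by fun_prop : Continuous fun z : X => (z, g z)))
  obtain ⟨⟨z, hyz, hz⟩, hmax⟩ := exists_maximal_of_chains_bounded
    (r := fun a b : S => Between x (a : X) b) (fun c hc => by
      rcases c.eq_empty_or_nonempty with rfl | hne
      · exact ⟨⟨y, Between.right _ _, h⟩, by simp⟩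
      have : Nonempty c := hne.to_subtype
      let T : c → Set X := fun a => S ∩ {b | Between x (a : S) b}
      let F : c → Set X := fun a => closure {b | ∃ b' : c, (b' : S) = b ∧ Between x (a : S) b}
      obtain ⟨z, hz⟩ : (⋂ a, F a).Nonempty := by
        refine IsCompact.nonempty_iInter_of_directed_nonempty_isCompact_isClosed _ ?_ ?_ ?_ ?_
        · intro a b
          rcases eq_or_ne a b with rfl | hab
          · exact ⟨a, subset_rfl, subset_rfl⟩
          rcases hc a.2 b.2 (fun h => hab (Subtype.ext h)) with hab | hab
          · exact ⟨b, closure_mono fun d ⟨d', hd, hbd⟩ => ⟨d', hd, hab.trans hbd⟩, subset_rfl⟩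
          · exact ⟨a, subset_rfl, closure_mono fun d ⟨d', hd, hbd⟩ => ⟨d', hd, hab.trans hbd⟩⟩
        · exact fun a => ⟨_, subset_closure ⟨a, rfl, Between.right _ _⟩⟩
        · exact fun a => isClosed_closure.isCompact
        · exact fun a => isClosed_closure
      have hT : ∀ a, z ∈ T a := fun a =>
        closure_minimal (by rintro _ ⟨b', rfl, hb⟩; exact ⟨b'.1.2, hb⟩)
          (hS.inter (hup _)) (mem_iInter.1 hz a)
      exact ⟨⟨z, (hT (Classical.arbitrary c)).1⟩, fun a ha => (hT ⟨a, ha⟩).2⟩)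
    (fun hab hbc => hab.trans hbc)
  refine ⟨z, ?_, hyz⟩
  by_contra hne
  obtain ⟨α, hα, hαi, h0, h1⟩ := exists_arc (Ne.symm hne)
  have hmono : ∀ {s t : ℝ}, 0 ≤ s → s ≤ t → t ≤ 1 → Between x (α s) (α t) :=
    Between.arc_mono hX hα hαi (by rwa [h0, h1])
  have hhalf : α (1 / 2) ≠ g z := fun h => by
    have := hαi (by norm_num) (by norm_num) (h.trans h1.symm)
    norm_num at this
  -- Points near `g z` lie beyond the midpoint of the arc from `z` to `g z`.
  let W := connectedComponentIn {α (1 / 2)}ᶜ (g z)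
  have hW : W ∈ 𝓝 (g z) := connectedComponentIn_mem_nhds
    (isOpen_compl_singleton.mem_nhds (by simpa using hhalf.symm))
  have hWb : ∀ w ∈ W, Between x (α (1 / 2)) w := by
    intro w hw C hC hxC hwC
    have hb : Between x (α (1 / 2)) (g z) := h1 ▸ hmono (by norm_num) (by norm_num) le_rfl
    rcases hb (C ∪ W) (hC.union w hwC hw isPreconnected_connectedComponentIn) (Or.inl hxC)
      (Or.inr (mem_of_mem_nhds hW)) with h | h
    · exact h
    · exact absurd rfl (connectedComponentIn_subset _ _ h)
  have hnear : ∀ᶠ t in 𝓝[>] (0 : ℝ), g (α t) ∈ W := by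
    refine nhdsWithin_le_nhds ((hg.comp hα).continuousAt.eventually_mem ?_)
    simpa [h0] using hW
  obtain ⟨t, htW, ht0, ht1⟩ := (hnear.and (Ioc_mem_nhdsGT (by norm_num : (0 : ℝ) < 1 / 2))).exists
  have hzt : Between x z (α t) := h0 ▸ hmono le_rfl ht0.le (by linarith)
  have htg : Between x (α t) (g (α t)) :=
    (hmono ht0.le ht1 (by norm_num)).trans (hWb _ htW)
  have heq : z = α t := Between.antisymm hzt (hmax ⟨α t, hyz.trans hzt, htg⟩ hzt)
  have := hαi (by norm_num) ⟨ht0.le, by linarith⟩ (h0.trans heq)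
  exact ht0.ne this

/-- If the fixed points of `g` form a connected set and `g` stretches a part of an arc over the
whole arc, preserving orientation, then `g` fixes every point of the arc. -/
theorem fixed_of_orientation_preserving {X : Type*} [MetricSpace X]
    [ConnectedSpace X] [LocallyPathConnectedSpace X] [CompactSpace X]
    (hX : ∀ S : Set X, ¬ IsSimpleClosedCurve S) {g : X → X} (hg : Continuous g)
    (hfix : IsPreconnected (Function.fixedPoints g)) {α : ℝ → X} (hα : Continuous α)
    (hαi : InjOn α (Icc 0 1)) {s t : ℝ} (hs : s ∈ Icc (0 : ℝ) 1) (ht : t ∈ Icc (0 : ℝ) 1)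
    (hst : s ≤ t) (hgs : g (α s) = α 0) (hgt : g (α t) = α 1) :
    ∀ r ∈ Icc (0 : ℝ) 1, g (α r) = α r := by
  have h0 : (0 : ℝ) ∈ Icc (0 : ℝ) 1 := by simp
  have h1 : (1 : ℝ) ∈ Icc (0 : ℝ) 1 := by simp
  have hne : α s ≠ α t := by
    intro h
    have := hαi h0 h1 (by rw [← hgs, ← hgt, h])
    norm_num at this
  obtain ⟨w, hw, hsw⟩ := exists_fixedPoint_beyond hX hg
    (hgs ▸ (between_of_injOn hX hα hαi hs).symm : Between (α 1) (α s) (g (α s)))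
  obtain ⟨w', hw', htw'⟩ := exists_fixedPoint_beyond hX hg
    (hgt ▸ between_of_injOn hX hα hαi ht : Between (α 0) (α t) (g (α t)))
  have hast : Between (α 0) (α s) (α t) :=
    between_of_injOn hX hα (hαi.mono (Icc_subset_Icc_right ht.2)) ⟨hs.1, hst⟩
  have hbts : Between (α 1) (α t) (α s) :=
    (between_of_injOn hX hα (hαi.mono (Icc_subset_Icc_left hs.1)) ⟨hst, ht.2⟩).symm
  have hsfix : g (α s) = α s :=
    Between.of_beyond hX hne hast hbts hsw htw' (Function.fixedPoints g) hfix hw hw'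
  have htfix : g (α t) = α t :=
    Between.of_beyond hX hne.symm hbts hast htw' hsw (Function.fixedPoints g) hfix hw' hw
  intro r hr
  refine between_of_injOn hX hα hαi hr (Function.fixedPoints g) hfix ?_ ?_
  · rw [Function.mem_fixedPoints, Function.IsFixedPt, ← hgs, hsfix, hsfix]
  · rw [Function.mem_fixedPoints, Function.IsFixedPt, ← hgt, htfix, htfix]

/-- If `g` stretches an arc over itself, reversing orientation, then its second iterate does so
preserving orientation: `g ∘ g` maps `α s'` to `α 0` and `α t'` to `α 1`, and `s' ≤ t'`. -/
theorem exists_orientation_preserving_of_reversing {X : Type*} [MetricSpace X]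
    [LocallyPathConnectedSpace X]
    (hX : ∀ S : Set X, ¬ IsSimpleClosedCurve S) {g : X → X} (hg : Continuous g) {α : ℝ → X}
    (hα : Continuous α) (hαi : InjOn α (Icc 0 1)) {s t : ℝ} (hs : s ∈ Icc (0 : ℝ) 1)
    (ht : t ∈ Icc (0 : ℝ) 1) (hts : t ≤ s) (hgs : g (α s) = α 0) (hgt : g (α t) = α 1) :
    ∃ s' ∈ Icc (0 : ℝ) 1, ∃ t' ∈ Icc (0 : ℝ) 1, s' ≤ t' ∧ g (α s') = α s ∧ g (α t') = α t := by
  have hclosed : ∀ x, IsClosed {r | Between x (α r) (g (α r))} := fun x =>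
    (Between.isClosed_setOf x).preimage (by fun_prop : Continuous fun r => (α r, g (α r)))
  -- Some `α r` with `t ≤ r ≤ s` separates `g (α r)` from both ends of the arc.
  obtain ⟨r, hr, hr0, hr1⟩ : ∃ r ∈ Icc t s, Between (α 0) (α r) (g (α r)) ∧
      Between (α 1) (α r) (g (α r)) :=
    isPreconnected_closed_iff.1 isPreconnected_Icc _ _ (hclosed (α 0)) (hclosed (α 1))
      (fun r hr => (between_of_injOn hX hα hαi
        ⟨ht.1.trans hr.1, hr.2.trans hs.2⟩).or_of_between _)
      ⟨t, ⟨le_rfl, hts⟩, show Between _ _ _ from hgt ▸ between_of_injOn hX hα hαi ht⟩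
      ⟨s, ⟨hts, le_rfl⟩, show Between _ _ _ from hgs ▸ (between_of_injOn hX hα hαi hs).symm⟩
  have hr01 : r ∈ Icc (0 : ℝ) 1 := ⟨ht.1.trans hr.1, hr.2.trans hs.2⟩
  have himg : ∀ u v : ℝ, IsPreconnected ((g ∘ α) '' Icc u v) := fun u v =>
    isPreconnected_Icc.image _ (hg.comp hα).continuousOn
  have h1 : α 1 ∈ (g ∘ α) '' Icc t r := ⟨t, ⟨le_rfl, hr.1⟩, hgt⟩
  have h2 : α r ∈ (g ∘ α) '' Icc t r := hr1 _ (himg t r) h1 ⟨r, ⟨hr.1, le_rfl⟩, rfl⟩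
  obtain ⟨s', hs', hgs'⟩ := between_of_injOn hX hα (hαi.mono (Icc_subset_Icc_left hr01.1))
    ⟨hr.2, hs.2⟩ _ (himg t r) h2 h1
  have h3 : α 0 ∈ (g ∘ α) '' Icc r s := ⟨s, ⟨hr.2, le_rfl⟩, hgs⟩
  have h4 : α r ∈ (g ∘ α) '' Icc r s := hr0 _ (himg r s) h3 ⟨r, ⟨le_rfl, hr.2⟩, rfl⟩
  obtain ⟨t', ht', hgt'⟩ := between_of_injOn hX hα (hαi.mono (Icc_subset_Icc_right hr01.2))
    ⟨ht.1, hr.1⟩ _ (himg r s) h3 h4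
  exact ⟨s', ⟨ht.1.trans hs'.1, hs'.2.trans hr01.2⟩, t', ⟨hr01.1.trans ht'.1, ht'.2.trans hs.2⟩,
    hs'.2.trans ht'.1, hgs', hgt'⟩

/-- An arc expanded by `g` makes the fixed points of `g` or of its second iterate
disconnected. -/
theorem not_isPreconnected_fixedPoints_of_ssubset_image {X : Type*} [MetricSpace X]
    [ConnectedSpace X] [LocallyPathConnectedSpace X] [CompactSpace X]
    (hX : ∀ S : Set X, ¬ IsSimpleClosedCurve S) {g : X → X} (hg : Continuous g) {α : ℝ → X}
    (hα : Continuous α) (hαi : InjOn α (Icc 0 1)) (hexp : α '' Icc 0 1 ⊂ g '' (α '' Icc 0 1)) :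
    ¬ IsPreconnected (Function.fixedPoints g) ∨ ¬ IsPreconnected (Function.fixedPoints (g ∘ g)) := by
  obtain ⟨_, ⟨s, hs, rfl⟩, hgs⟩ := hexp.1 ⟨0, by simp, rfl⟩
  obtain ⟨_, ⟨t, ht, rfl⟩, hgt⟩ := hexp.1 ⟨1, by simp, rfl⟩
  have hnot : ∀ k : X → X, g '' (α '' Icc 0 1) ⊆ k '' (α '' Icc 0 1) →
      ¬ ∀ r ∈ Icc (0 : ℝ) 1, k (α r) = α r := by
    refine fun k hk hfix => hexp.2 (hk.trans ?_)
    rintro _ ⟨_, ⟨r, hr, rfl⟩, rfl⟩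
    exact ⟨r, hr, (hfix r hr).symm⟩
  rcases le_total s t with hst | hts
  · exact Or.inl fun hfix => hnot g subset_rfl
      (fixed_of_orientation_preserving hX hg hfix hα hαi hs ht hst hgs hgt)
  · obtain ⟨s', hs', t', ht', hst', hgs', hgt'⟩ :=
      exists_orientation_preserving_of_reversing hX hg hα hαi hs ht hts hgs hgt
    refine Or.inr fun hfix => hnot (g ∘ g) (by rw [image_comp]; exact image_mono hexp.1)
      (fixed_of_orientation_preserving hX (hg.comp hg) hfix hα hαi hs' ht' hst' ?_ ?_)
    · rw [Function.comp_apply, hgs', hgs]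
    · rw [Function.comp_apply, hgt', hgt]

/-- Such a set contains, with any two of its points, an arc joining them. -/
theorem isPreconnected_of_between {X : Type*} [MetricSpace X] [ConnectedSpace X]
    [LocallyPathConnectedSpace X]
    (hX : ∀ S : Set X, ¬ IsSimpleClosedCurve S) {F : Set X}
    (h : ∀ p ∈ F, ∀ q ∈ F, ∀ z, Between p z q → z ∈ F) : IsPreconnected F := by
  refine isPreconnected_of_forall_pair fun p hp q hq => ?_
  by_cases hpq : p = q
  · subst hpq
    exact ⟨{p}, by simpa using hp, rfl, rfl, isPreconnected_singleton⟩
  obtain ⟨α, hα, hαi, rfl, rfl⟩ := exists_arc hpq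
  refine ⟨α '' Icc 0 1, ?_, ⟨0, by simp, rfl⟩, ⟨1, by simp, rfl⟩,
    isPreconnected_Icc.image _ hα.continuousOn⟩
  rintro _ ⟨t, ht, rfl⟩
  exact h _ hp _ hq _ (between_of_injOn hX hα hαi ht)

/-! ### Arcs as subspaces -/

theorem isArcBetween_image {X : Type*} [TopologicalSpace X] [T2Space X] {α : ℝ → X}
    (hα : Continuous α) (hαi : InjOn α (Icc 0 1)) : IsArcBetween (α '' Icc 0 1) (α 0) (α 1) := by
  have hc : Continuous fun t : unitInterval => α t := by fun_prop
  have hi : Function.Injective fun t : unitInterval => α t :=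
    fun s t hst => Subtype.ext (hαi s.2 t.2 hst)
  have hr : range (fun t : unitInterval => α t) = α '' Icc 0 1 := (image_eq_range _ _).symm
  exact ⟨(hc.isClosedEmbedding hi).isEmbedding.toHomeomorph.trans (Homeomorph.setCongr hr),
    rfl, rfl⟩

theorem IsArcBetween.exists_injOn {X : Type*} [TopologicalSpace X] {A : Set X} {x y : X}
    (hA : IsArcBetween A x y) :
    ∃ α : ℝ → X, Continuous α ∧ InjOn α (Icc 0 1) ∧ α 0 = x ∧ α 1 = y ∧ α '' Icc 0 1 = A := by
  obtain ⟨h, rfl, rfl⟩ := hA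
  refine ⟨IccExtend zero_le_one fun t => (h t : X),
    (continuous_subtype_val.comp h.continuous).Icc_extend', fun s hs t ht hst => ?_,
    IccExtend_left _ _, IccExtend_right _ _, ?_⟩
  · rw [IccExtend_of_mem _ _ hs, IccExtend_of_mem _ _ ht] at hst
    exact congrArg Subtype.val (h.injective (Subtype.ext hst))
  · ext a
    constructor
    · rintro ⟨t, ht, rfl⟩
      rw [IccExtend_of_mem _ _ ht]
      exact (h _).2
    · intro ha
      refine ⟨h.symm ⟨a, ha⟩, (h.symm ⟨a, ha⟩).2, ?_⟩
      rw [IccExtend_of_mem _ _ (h.symm ⟨a, ha⟩).2]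
      simp

theorem IsArcBetween.isArc {X : Type*} [TopologicalSpace X] {A : Set X} {x y : X}
    (hA : IsArcBetween A x y) : IsArc A :=
  ⟨hA.choose⟩

theorem IsArc.exists_injOn {X : Type*} [TopologicalSpace X] {A : Set X} (hA : IsArc A) :
    ∃ α : ℝ → X, Continuous α ∧ InjOn α (Icc 0 1) ∧ α '' Icc 0 1 = A := by
  obtain ⟨h⟩ := hA
  obtain ⟨α, hα, hαi, -, -, hA⟩ := IsArcBetween.exists_injOn ⟨h, rfl, rfl⟩
  exact ⟨α, hα, hαi, hA⟩

/-- The arc from `x` to `y` consists of the points between `x` and `y`. -/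
theorem IsArcBetween.mem_iff_between {X : Type*} [MetricSpace X] [LocallyPathConnectedSpace X]
    (hX : ∀ S : Set X, ¬ IsSimpleClosedCurve S) {A : Set X} {x y z : X}
    (hA : IsArcBetween A x y) : z ∈ A ↔ Between x z y := by
  obtain ⟨α, hα, hαi, rfl, rfl, rfl⟩ := hA.exists_injOn
  constructor
  · rintro ⟨t, ht, rfl⟩
    exact between_of_injOn hX hα hαi ht
  · exact fun h => h _ (isPreconnected_Icc.image _ hα.continuousOn) ⟨0, by simp, rfl⟩
      ⟨1, by simp, rfl⟩

theorem exists_isArcBetween {X : Type*} [MetricSpace X] [ConnectedSpace X]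
    [LocallyPathConnectedSpace X] {x y : X} (hxy : x ≠ y) : ∃ A : Set X, IsArcBetween A x y := by
  obtain ⟨α, hα, hαi, rfl, rfl⟩ := exists_arc hxy
  exact ⟨_, isArcBetween_image hα hαi⟩

theorem IsArcBetween.isPreconnected {X : Type*} [TopologicalSpace X] {A : Set X} {x y : X}
    (hA : IsArcBetween A x y) : IsPreconnected A := by
  obtain ⟨α, hα, -, -, -, rfl⟩ := hA.exists_injOn
  exact isPreconnected_Icc.image _ hα.continuousOn

/-! ### The three conditions -/

theorem mainTheorem4 {X : Type*} [MetricSpace X] (hX : IsDendrite X)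
    (f : X → X) (hf : Continuous f) :
    List.TFAE [
      ∃ A : Set X, IsExpandingArc f A,
      ∃ n : ℕ, 0 < n ∧ ¬ IsPreconnected (Function.fixedPoints f^[n]),
      ∃ (x y : X) (n : ℕ), 0 < n ∧ f^[n] x = x ∧ f^[n] y ≠ y ∧
        ∃ A : Set X, IsArcBetween A x (f^[n] y) ∧ y ∈ A] := by
  obtain ⟨_, _, _, hS⟩ := hX
  have : LocallyPathConnectedSpace X := .of_complete_locallyConnected
  tfae_have 1 → 2 := by
    rintro ⟨A, hA, n, hn, hexp⟩
    obtain ⟨α, hα, hαi, rfl⟩ := hA.exists_injOn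
    rcases not_isPreconnected_fixedPoints_of_ssubset_image hS (hf.iterate n) hα hαi hexp with h | h
    · exact ⟨n, hn, h⟩
    · exact ⟨n + n, by omega, by rwa [Function.iterate_add]⟩
  tfae_have 2 → 3 := by
    rintro ⟨n, hn, h⟩
    obtain ⟨p, hp, q, hq, z, hz, hzn⟩ : ∃ p, f^[n] p = p ∧ ∃ q, f^[n] q = q ∧
        ∃ z, Between p z q ∧ f^[n] z ≠ z := by
      by_contra! hcon
      exact h (isPreconnected_of_between hS fun p hp q hq z hz => hcon p hp q hq z hz)
    -- The non-fixed point `z` is moved away from `p` or from `q`.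
    have key : ∀ x, f^[n] x = x → Between x z (f^[n] z) → ∃ (x y : X) (n : ℕ), 0 < n ∧
        f^[n] x = x ∧ f^[n] y ≠ y ∧ ∃ A : Set X, IsArcBetween A x (f^[n] y) ∧ y ∈ A := by
      intro x hx hxz
      have hne : x ≠ f^[n] z := fun h => hzn (by
        have hzx : z = x := (h ▸ hxz : Between x z x).eq_of_self
        rw [hzx, hx])
      obtain ⟨A, hA⟩ := exists_isArcBetween hne
      exact ⟨x, z, n, hn, hx, hzn, A, hA, (hA.mem_iff_between hS).2 hxz⟩
    rcases hz.or_of_between (f^[n] z) with h | h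
    exacts [key p hp h, key q hq h]
  tfae_have 3 → 1 := by
    rintro ⟨x, y, n, hn, hx, hy, B, hB, hyB⟩
    rw [hB.mem_iff_between hS] at hyB
    have hne : x ≠ y := by rintro rfl; exact hy hx
    obtain ⟨A, hA⟩ := exists_isArcBetween hne
    have hxA : x ∈ A := (hA.mem_iff_between hS).2 (Between.left _ _)
    have hyA : y ∈ A := (hA.mem_iff_between hS).2 (Between.right _ _)
    have himg : IsPreconnected (f^[n] '' A) :=
      hA.isPreconnected.image _ (hf.iterate n).continuousOn
    have hxI : x ∈ f^[n] '' A := ⟨x, hxA, hx⟩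
    have hfyI : f^[n] y ∈ f^[n] '' A := ⟨y, hyA, rfl⟩
    refine ⟨A, hA.isArc, n, hn, fun z hz => ?_, fun hsub => hy ?_⟩
    · exact (hA.mem_iff_between hS).1 hz _ himg hxI (hyB _ himg hxI hfyI)
    · exact Between.antisymm ((hA.mem_iff_between hS).1 (hsub hfyI)) hyB
  tfae_finish
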